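/- Let $\mathcal X$ be a set with a symmetric neighbour relation $\mathcal N\subseteq\mathcal X^2$, and let $\mathcal Z$ be a measurable space. For $\varepsilon\ge 0$ and $\delta\ge 0$, a mechanism, i.e. a family $(M_x)_{x\in\mathcal X}$ of probability measures on a measurable space $\mathcal Y$, is called $(\varepsilon,\delta)$-differentially private if $M_x(S)\le e^{\varepsilon}M_{x'}(S)+\delta$ for all $(x,x')\in\mathcal N$ and all measurable $S\subseteq\mathcal Y$. Let $Q$ be a probability measure on $\mathcal Z$ and let $P_{Z|X}=(P_{Z|X}(\cdot|x))_{x\in\mathcal X}$ be a mechanism on $\mathcal Z$ with $P_{Z|X}(\cdot|x)\ll Q$ for every $x$. For $\alpha\in(1,\infty)$, the Poisson private representation (PPR) of $P_{Z|X}$ with parameter $\alpha$ and proposal distribution $Q$ is the following mechanism $P_{(Z_i)_i,K|X}$ on $\mathcal Z^{\infty}\times\mathbb Z_{>0}$. Given $x$, write $P=P_{Z|X}(\cdot|x)$; let $Z_1,Z_2,\ldots$ be i.i.d. with law $Q$, independent of a Poisson process $0<T_1<T_2<\cdots$ of rate $1$ (that is, $T_1,T_2-T_1,T_3-T_2,\ldots$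 are i.i.d. $\mathrm{Exp}(1)$); put $\tilde T_i=T_i\cdot\big(\tfrac{\mathrm dP}{\mathrm dQ}(Z_i)\big)^{-1}$, with $\tilde T_i=\infty$ if $\tfrac{\mathrm dP}{\mathrm dQ}(Z_i)=0$; and, given $(Z_i,T_i)_i$, draw $K$ with $$\Pr\big(K=k\,\big|\,(Z_i,T_i)_i\big)=\frac{\tilde T_k^{-\alpha}}{\sum_{i=1}^{\infty}\tilde T_i^{-\alpha}},\qquad k=1,2,\ldots$$ The output is $((Z_i)_i,K)$. Theorem. Let $\varepsilon,\delta\ge 0$ and $\alpha>1$. If $P_{Z|X}$ is $(\varepsilon,\delta)$-differentially private, then the PPR $P_{(Z_i)_i,K|X}$ with parameter $\alpha$ is $(\alpha\varepsilon+\tilde\varepsilon,\,2(\delta+\tilde\delta))$-differentially private, for every $\tilde\varepsilon\in(0,1]$ and $\tilde\delta\in(0,1/3]$ that satisfy $$\alpha\le \frac{e^{-4.2}\,\tilde\delta\,\tilde\varepsilon^{2}}{-\ln\tilde\delta}+1 .$$ -/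

import Mathlib

open MeasureTheory ProbabilityTheory
open scoped ENNReal

/-- `(ε, δ)`-differential privacy of a mechanism `M` (the conditional law of the output
given each input `x`), with respect to the neighbour relation `N`:
`Pr(Z ∈ S | X = x) ≤ e ^ ε * Pr(Z ∈ S | X = x') + δ` for all neighbours `x, x'` and all
events `S`. -/
def IsDP {𝒳 𝒴 : Type*} [MeasurableSpace 𝒴] (N : 𝒳 → 𝒳 → Prop) (ε δ : ℝ)
    (M : 𝒳 → Measure 𝒴) : Prop :=
  ∀ x x' : 𝒳, N x x' → ∀ S : Set 𝒴, MeasurableSet S →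
    M x S ≤ ENNReal.ofReal (Real.exp ε) * M x' S + ENNReal.ofReal δ

namespace PPR

noncomputable section

instance : IsProbabilityMeasure (expMeasure 1) :=
  isProbabilityMeasure_expMeasure one_pos

/-- Law of the gaps `T₁, T₂ - T₁, T₃ - T₂, …` of a Poisson process of rate `1`:
i.i.d. `Exp(1)`.  Sequences are indexed from `0`: entry `i` is the `(i + 1)`-st gap. -/
def gapLaw : Measure (ℕ → ℝ) := Measure.infinitePi fun _ => expMeasure 1

/-- Law of the shared randomness: i.i.d. samples of the proposal distribution `Q`
(entry `i` is the `(i + 1)`-st sample). -/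
def sharedLaw {𝒵 : Type*} [MeasurableSpace 𝒵] (Q : Measure 𝒵) [IsProbabilityMeasure Q] :
    Measure (ℕ → 𝒵) := Measure.infinitePi fun _ => Q

instance : IsProbabilityMeasure gapLaw := by
  unfold gapLaw
  infer_instance

instance {𝒵 : Type*} [MeasurableSpace 𝒵] (Q : Measure 𝒵) [IsProbabilityMeasure Q] :
    IsProbabilityMeasure (sharedLaw Q) := by
  unfold sharedLaw
  infer_instance

/-- The `(i + 1)`-st arrival time of the process with gaps `e`. -/
def arrival (e : ℕ → ℝ) (i : ℕ) : ℝ := ∑ j ∈ Finset.range (i + 1), e j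

variable {𝒵 : Type*} [MeasurableSpace 𝒵]

/-- The scaled times `T_i * (dP/dQ (Z_i))⁻¹`, with value `∞` where the density vanishes
(for `T_i > 0`, which holds almost surely). -/
def scaledTime (Q P : Measure 𝒵) (ω : (ℕ → ℝ) × (ℕ → 𝒵)) (i : ℕ) : ℝ≥0∞ :=
  ENNReal.ofReal (arrival ω.1 i) * (P.rnDeriv Q (ω.2 i))⁻¹

/-- The probability of the index `k` given gaps and samples. -/
def indexProb (α : ℝ) (Q P : Measure 𝒵) (ω : (ℕ → ℝ) × (ℕ → 𝒵)) (k : ℕ) : ℝ≥0∞ :=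
  scaledTime Q P ω k ^ (-α) / ∑' i, scaledTime Q P ω i ^ (-α)

lemma measurable_indexProb (α : ℝ) (Q P : Measure 𝒵) (k : ℕ) :
    Measurable fun ω => indexProb α Q P ω k := by
  have h : ∀ i, Measurable fun ω : (ℕ → ℝ) × (ℕ → 𝒵) => scaledTime Q P ω i ^ (-α) := by
    intro i
    have h1 : Measurable fun ω : (ℕ → ℝ) × (ℕ → 𝒵) => arrival ω.1 i := by
      unfold arrival
      fun_prop
    have h2 : Measurable fun ω : (ℕ → ℝ) × (ℕ → 𝒵) => P.rnDeriv Q (ω.2 i) :=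
      (Measure.measurable_rnDeriv P Q).comp ((measurable_pi_apply i).comp measurable_snd)
    exact (h1.ennreal_ofReal.mul h2.inv).pow_const _
  exact (h k).div (Measurable.tsum h)

/-- The conditional law of the index given gaps and samples. -/
def indexKernel (α : ℝ) (Q P : Measure 𝒵) : Kernel ((ℕ → ℝ) × (ℕ → 𝒵)) ℕ where
  toFun ω := Measure.sum fun k => indexProb α Q P ω k • Measure.dirac k
  measurable' := by
    refine Measure.measurable_of_measurable_coe _ fun s hs => ?_
    simp only [Measure.sum_apply _ hs, Measure.smul_apply, smul_eq_mul]
    exact Measurable.tsum fun k => (measurable_indexProb α Q P k).mul_const _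

/-- The index kernel is finite, so that its composition products are not junk values. -/
instance (α : ℝ) (Q P : Measure 𝒵) : IsFiniteKernel (indexKernel α Q P) := by
  refine ⟨⟨1, ENNReal.one_lt_top, fun ω => ?_⟩⟩
  change (Measure.sum fun k => indexProb α Q P ω k • Measure.dirac k) Set.univ ≤ 1
  simp only [Measure.sum_apply _ MeasurableSet.univ, Measure.smul_apply, smul_eq_mul,
    measure_univ, mul_one, indexProb, div_eq_mul_inv]
  rw [ENNReal.tsum_mul_right]
  exact ENNReal.mul_inv_le_one _

/-- Law of what the decoder knows, `((Z_i)_i, K)`, under Poisson private representation with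
parameter `α` and proposal distribution `Q` applied to the distribution `P`: the arrival times
and the samples are independent, and then `K` is drawn from `indexKernel`.  Only the samples and
the index are kept.  (The index `k` stands for `K = k + 1`.) -/
def law (α : ℝ) (Q : Measure 𝒵) [IsProbabilityMeasure Q] (P : Measure 𝒵) :
    Measure ((ℕ → 𝒵) × ℕ) :=
  ((gapLaw.prod (sharedLaw Q)) ⊗ₘ (indexKernel α Q P)).map fun p => (p.1.2, p.2)

end

end PPR

/-! Both mechanisms can be run on the same arrival times and samples, so it is enough to compare the
two index probabilities point by point. Let f and g be the densities of P and P' with respect to Q,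
and let c = e^ε.

Numerators: T_k^(-α) f(Z_k)^α is at most c^α T_k^(-α) g(Z_k)^α where f ≤ c g. Elsewhere Bernoulli's
inequality charges the surplus to a fraction 2 (1 - c g / f) of the weight (`weight_le`). The
selected sample has law P (`lintegral_select_le`), so the expected surplus is at most 2 ∫ (f - c g)₊
dQ ≤ 2 δ (`lintegral_excess_le`).

Denominators: whatever P is, the scaled times form a Poisson process of rate 1, and for α close to 1
the sum of their powers -α is nearly deterministic. The points beyond δ' contribute a mean of order
1 / (α - 1) with small relative fluctuations, and a point before δ' occurs with probability at most
δ'. Hence the total under P' exceeds e^ε' times the total under P with probability at most 2 δ'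
(`measure_total_ratio_le`).

Everything needed about the scaled times follows from the Mecke equation (`mecke`): a sum over the
points is an integral over one extra inserted point. It comes from the memorylessness of the gaps.
Rescaling time by the density then turns Q into P (`mecke_scaledTime`). -/

namespace PPR

/-! ### Splitting the first term off an i.i.d. sequence -/

/-- Prepend a term to a sequence. -/
def seqCons {β : Type*} (a : β) (x : ℕ → β) : ℕ → β
  | 0 => a
  | n + 1 => x n

@[simp] lemma seqCons_zero {β : Type*} (a : β) (x : ℕ → β) : seqCons a x 0 = a := rfl

@[simp] lemma seqCons_succ {β : Type*} (a : β) (x : ℕ → β) (n : ℕ) :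
    seqCons a x (n + 1) = x n := rfl

@[fun_prop]
lemma measurable_seqCons {β γ : Type*} [MeasurableSpace β] [MeasurableSpace γ] {f : γ → β}
    {g : γ → ℕ → β} (hf : Measurable f) (hg : Measurable g) :
    Measurable fun c => seqCons (f c) (g c) := by
  refine measurable_pi_iff.2 fun n => ?_
  cases n with
  | zero => exact hf
  | succ n => exact (measurable_pi_apply n).comp hg

lemma map_seqCons {β : Type*} [MeasurableSpace β] (μ : Measure β) [IsProbabilityMeasure μ] :
    (μ.prod (Measure.infinitePi fun _ : ℕ => μ)).map (fun p => seqCons p.1 p.2)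
      = Measure.infinitePi fun _ : ℕ => μ := by
  classical
  refine Measure.eq_infinitePi _ fun s t ht => ?_
  -- A superset of the form `range (n + 1)` contains the index 0, so that coordinate can be split
  -- off; coordinates outside `s` receive `univ`.
  obtain ⟨n, hn⟩ : ∃ n, s ⊆ Finset.range (n + 1) := by
    obtain ⟨n, hn⟩ := s.exists_nat_subset_range
    exact ⟨n, hn.trans (Finset.range_mono n.le_succ)⟩
  set u : ℕ → Set β := fun i => if i ∈ s then t i else Set.univ with hu
  have hum : ∀ i, MeasurableSet (u i) := fun i => by
    simp only [hu]; split_ifs <;> simp [ht]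
  have hpi : Set.pi (s : Set ℕ) t = Set.pi (Finset.range (n + 1) : Set ℕ) u := by
    ext x
    simp only [Set.mem_pi, Finset.mem_coe, hu]
    constructor
    · intro h i _
      split_ifs with hi
      · exact h i hi
      · trivial
    · intro h i hi
      have := h i (hn hi)
      rwa [if_pos hi] at this
  have hprod : ∏ i ∈ s, μ (t i) = ∏ i ∈ Finset.range (n + 1), μ (u i) := by
    rw [← Finset.prod_subset hn (fun i _ hi => by simp [hu, hi])]
    exact Finset.prod_congr rfl fun i hi => by simp [hu, hi]
  rw [hpi, hprod, Measure.map_apply (by fun_prop)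
    (MeasurableSet.pi (Finset.countable_toSet _) fun i _ => hum i), Finset.prod_range_succ']
  have hpre : (fun p : β × (ℕ → β) => seqCons p.1 p.2) ⁻¹'
      (Set.pi (Finset.range (n + 1) : Set ℕ) u)
      = u 0 ×ˢ Set.pi (Finset.range n : Set ℕ) fun i => u (i + 1) := by
    ext p
    simp only [Set.mem_preimage, Set.mem_pi, Finset.coe_range, Set.mem_Iio, Set.mem_prod]
    constructor
    · intro h
      exact ⟨h 0 (by omega), fun i hi => h (i + 1) (by omega)⟩
    · rintro ⟨h0, h1⟩ i hi
      cases i with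
      | zero => exact h0
      | succ i => exact h1 i (by omega)
  rw [hpre, Measure.prod_prod, Measure.infinitePi_pi _ (fun i _ => hum (i + 1)), mul_comm]

variable {𝒵 : Type*} [MeasurableSpace 𝒵]

/-- The joint law of the gaps and the samples. -/
noncomputable abbrev jointLaw (Q : Measure 𝒵) [IsProbabilityMeasure Q] :
    Measure ((ℕ → ℝ) × (ℕ → 𝒵)) := gapLaw.prod (sharedLaw Q)

lemma lintegral_jointLaw (Q : Measure 𝒵) [IsProbabilityMeasure Q]
    {G : (ℕ → ℝ) × (ℕ → 𝒵) → ℝ≥0∞} (hG : Measurable G) :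
    ∫⁻ ω, G ω ∂jointLaw Q
      = ∫⁻ a, ∫⁻ z, ∫⁻ ω, G (seqCons a ω.1, seqCons z ω.2) ∂jointLaw Q ∂Q ∂expMeasure 1 := by
  have h1 : gapLaw = ((expMeasure 1).prod gapLaw).map (fun p => seqCons p.1 p.2) :=
    (map_seqCons _).symm
  have h2 : sharedLaw Q = (Q.prod (sharedLaw Q)).map (fun p => seqCons p.1 p.2) :=
    (map_seqCons _).symm
  have hstep : ∀ e : ℕ → ℝ, ∫⁻ y, G (e, y) ∂sharedLaw Q
      = ∫⁻ z, ∫⁻ y, G (e, seqCons z y) ∂sharedLaw Q ∂Q := by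
    intro e
    conv_lhs => rw [h2]
    rw [lintegral_map (by fun_prop) (by fun_prop), lintegral_prod _ (by fun_prop)]
  rw [jointLaw, lintegral_prod _ (by fun_prop)]
  simp_rw [hstep]
  have hm : Measurable fun e : ℕ → ℝ => ∫⁻ z, ∫⁻ y, G (e, seqCons z y) ∂sharedLaw Q ∂Q := by
    refine Measurable.lintegral_prod_right' (f := fun p : (ℕ → ℝ) × 𝒵 =>
      ∫⁻ y, G (p.1, seqCons p.2 y) ∂sharedLaw Q) ?_
    exact Measurable.lintegral_prod_right' (f := fun p : ((ℕ → ℝ) × 𝒵) × (ℕ → 𝒵) =>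
      G (p.1.1, seqCons p.1.2 p.2)) (by fun_prop)
  conv_lhs => rw [h1]
  have hm' : Measurable fun p : ℝ × (ℕ → ℝ) =>
      ∫⁻ z, ∫⁻ y, G (seqCons p.1 p.2, seqCons z y) ∂sharedLaw Q ∂Q :=
    hm.comp (measurable_seqCons measurable_fst measurable_snd)
  rw [lintegral_map hm (by fun_prop), lintegral_prod _ hm'.aemeasurable]
  refine lintegral_congr fun a => ?_
  rw [lintegral_lintegral_swap]
  · refine lintegral_congr fun z => ?_
    rw [lintegral_prod _ (by fun_prop)]
  · refine Measurable.aemeasurable ?_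
    exact Measurable.lintegral_prod_right' (f := fun p : ((ℕ → ℝ) × 𝒵) × (ℕ → 𝒵) =>
      G (seqCons a p.1.1, seqCons p.1.2 p.2)) (by fun_prop)

lemma lintegral_expMeasure_add (s : ℝ) {f : ℝ → ℝ≥0∞} (hf : Measurable f) :
    ∫⁻ a, f (s + a) ∂expMeasure 1
      = ∫⁻ t in Set.Ioi s, ENNReal.ofReal (Real.exp (s - t)) * f t := by
  have hpdf : Measurable (exponentialPDF 1) :=
    (measurable_exponentialPDFReal 1).ennreal_ofReal
  change ∫⁻ a, f (s + a) ∂(volume.withDensity (exponentialPDF 1)) = _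
  rw [lintegral_withDensity_eq_lintegral_mul _ hpdf (by fun_prop)]
  rw [← lintegral_add_left_eq_self _ (-s), setLIntegral_congr Ioi_ae_eq_Ici,
    ← lintegral_indicator measurableSet_Ici]
  refine lintegral_congr fun t => ?_
  simp only [Pi.mul_apply, exponentialPDF_eq, Set.indicator, Set.mem_Ici]
  by_cases h : s ≤ t
  · rw [if_pos h, if_pos (by linarith)]
    ring_nf
  · rw [if_neg h, if_neg (by linarith)]
    simp

/-! ### The marked Poisson process and its memorylessness -/

/-- The sum of `φ` over the marked points of the process started at time `s`. -/
noncomputable def pointSum (φ : ℝ × 𝒵 → ℝ≥0∞) (s : ℝ) (ω : (ℕ → ℝ) × (ℕ → 𝒵)) : ℝ≥0∞ :=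
  ∑' i, φ (s + arrival ω.1 i, ω.2 i)

@[fun_prop]
lemma measurable_arrival (i : ℕ) : Measurable fun e => arrival e i := by
  unfold arrival
  fun_prop

@[fun_prop]
lemma measurable_pointSum {γ : Type*} [MeasurableSpace γ] {φ : ℝ × 𝒵 → ℝ≥0∞} (hφ : Measurable φ)
    {f : γ → ℝ} (hf : Measurable f) {g : γ → (ℕ → ℝ) × (ℕ → 𝒵)} (hg : Measurable g) :
    Measurable fun c => pointSum φ (f c) (g c) := by
  unfold pointSum
  refine Measurable.tsum fun i => hφ.comp ?_
  have := measurable_arrival i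
  fun_prop

lemma arrival_seqCons_succ (a : ℝ) (e : ℕ → ℝ) (i : ℕ) :
    arrival (seqCons a e) (i + 1) = a + arrival e i := by
  simp only [arrival]
  rw [Finset.sum_range_succ', add_comm]
  simp

lemma arrival_seqCons_zero (a : ℝ) (e : ℕ → ℝ) : arrival (seqCons a e) 0 = a := by
  simp [arrival]

omit [MeasurableSpace 𝒵] in
lemma pointSum_seqCons (φ : ℝ × 𝒵 → ℝ≥0∞) (s a : ℝ) (z : 𝒵) (ω : (ℕ → ℝ) × (ℕ → 𝒵)) :
    pointSum φ s (seqCons a ω.1, seqCons z ω.2) = φ (s + a, z) + pointSum φ (s + a) ω := by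
  unfold pointSum
  rw [tsum_eq_zero_add' ENNReal.summable]
  simp [arrival_seqCons_zero, arrival_seqCons_succ, add_assoc]

/-- Memorylessness: on the event that the first point comes after `t`, the process started at `s`
looks like the process started at `t`. -/
lemma lintegral_pointSum_memoryless (Q : Measure 𝒵) [IsProbabilityMeasure Q]
    {φ : ℝ × 𝒵 → ℝ≥0∞} (hφ : Measurable φ) {H : ℝ≥0∞ → ℝ≥0∞} (hH : Measurable H)
    {s t : ℝ} (hst : s ≤ t) :
    ∫⁻ ω, (if t < s + ω.1 0 then H (pointSum φ s ω) else 0) ∂jointLaw Q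
      = ENNReal.ofReal (Real.exp (s - t)) * ∫⁻ ω, H (pointSum φ t ω) ∂jointLaw Q := by
  -- `K r` is the expectation given that the first point is at `r`. Both sides integrate `K` over r
  -- > t, and the densities match since e^(s - r) = e^(s - t) e^(t - r).
  set K : ℝ → ℝ≥0∞ := fun r => ∫⁻ z, ∫⁻ ω, H (φ (r, z) + pointSum φ r ω) ∂jointLaw Q ∂Q with hK
  have hKm : Measurable K := by
    refine Measurable.lintegral_prod_right' (f := fun p : ℝ × 𝒵 =>
      ∫⁻ ω, H (φ (p.1, p.2) + pointSum φ p.1 ω) ∂jointLaw Q) ?_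
    exact Measurable.lintegral_prod_right' (f := fun p : (ℝ × 𝒵) × ((ℕ → ℝ) × (ℕ → 𝒵)) =>
      H (φ (p.1.1, p.1.2) + pointSum φ p.1.1 p.2)) (by fun_prop)
  have hset : MeasurableSet {ω : (ℕ → ℝ) × (ℕ → 𝒵) | t < s + ω.1 0} :=
    measurableSet_lt measurable_const (by fun_prop)
  have hl : ∫⁻ ω, (if t < s + ω.1 0 then H (pointSum φ s ω) else 0) ∂jointLaw Q
      = ∫⁻ a, (fun r => if t < r then K r else 0) (s + a) ∂expMeasure 1 := by
    rw [lintegral_jointLaw Q (Measurable.ite hset (by fun_prop) measurable_const)]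
    refine lintegral_congr fun a => ?_
    simp only [seqCons_zero, pointSum_seqCons]
    split_ifs with h
    · rfl
    · simp
  have hr : ∫⁻ ω, H (pointSum φ t ω) ∂jointLaw Q = ∫⁻ a, K (t + a) ∂expMeasure 1 := by
    rw [lintegral_jointLaw Q (by fun_prop)]
    simp only [pointSum_seqCons, hK]
  rw [hl, hr, lintegral_expMeasure_add s (Measurable.ite measurableSet_Ioi hKm measurable_const),
    lintegral_expMeasure_add t hKm, ← lintegral_const_mul _ (by fun_prop),
    ← lintegral_indicator measurableSet_Ioi, ← lintegral_indicator measurableSet_Ioi]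
  refine lintegral_congr fun r => ?_
  simp only [Set.indicator, Set.mem_Ioi]
  by_cases h : t < r
  · rw [if_pos h, if_pos h, if_pos (hst.trans_lt h), ← mul_assoc,
      ← ENNReal.ofReal_mul (Real.exp_nonneg _), ← Real.exp_add]
    ring_nf
  · simp [h]

/-! ### The Mecke equation -/

/-- The sum of the first `k` gaps. -/
noncomputable def gapSum (e : ℕ → ℝ) (k : ℕ) : ℝ := ∑ j ∈ Finset.range k, e j

@[fun_prop]
lemma measurable_gapSum (k : ℕ) : Measurable fun e => gapSum e k := by
  unfold gapSum
  fun_prop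

lemma gapSum_zero (e : ℕ → ℝ) : gapSum e 0 = 0 := by simp [gapSum]

lemma measurableSet_between_gapSum (s : ℝ) (k l : ℕ) :
    MeasurableSet {p : ((ℕ → ℝ) × (ℕ → 𝒵)) × ℝ |
      s + gapSum p.1.1 k ≤ p.2 ∧ p.2 < s + gapSum p.1.1 l} := by
  have h : ∀ j, Measurable fun p : ((ℕ → ℝ) × (ℕ → 𝒵)) × ℝ => s + gapSum p.1.1 j := fun j => by
    fun_prop
  exact (measurableSet_le (h k) measurable_snd).inter (measurableSet_lt measurable_snd (h l))

lemma gapSum_seqCons_succ (a : ℝ) (e : ℕ → ℝ) (k : ℕ) :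
    gapSum (seqCons a e) (k + 1) = a + gapSum e k := by
  simp only [gapSum]
  rw [Finset.sum_range_succ', add_comm]
  simp

/-- The expectation of `F` after a point with a random mark is added at time `p.1` to a
configuration with total `p.2`. -/
noncomputable def addPoint (Q : Measure 𝒵) (φ : ℝ × 𝒵 → ℝ≥0∞) (F : ℝ × 𝒵 × ℝ≥0∞ → ℝ≥0∞)
    (p : ℝ × ℝ≥0∞) : ℝ≥0∞ :=
  ∫⁻ z, F (p.1, z, p.2 + φ (p.1, z)) ∂Q

lemma measurable_addPoint (Q : Measure 𝒵) [IsProbabilityMeasure Q]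
    {φ : ℝ × 𝒵 → ℝ≥0∞} (hφ : Measurable φ) {F : ℝ × 𝒵 × ℝ≥0∞ → ℝ≥0∞} (hF : Measurable F) :
    Measurable (addPoint Q φ F) :=
  Measurable.lintegral_prod_right' (f := fun p : (ℝ × ℝ≥0∞) × 𝒵 =>
    F (p.1.1, p.2, p.1.2 + φ (p.1.1, p.2))) (by fun_prop)

/-- The density e^(s - t) of a first point at `t` is also the probability that no point has come by
time `t`, and on that event the process continues as if started at `t`. So a first point at `t`
amounts to a point inserted at `t` before all the others. -/
lemma lintegral_point_zero (Q : Measure 𝒵) [IsProbabilityMeasure Q]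
    {φ : ℝ × 𝒵 → ℝ≥0∞} (hφ : Measurable φ) {F : ℝ × 𝒵 × ℝ≥0∞ → ℝ≥0∞} (hF : Measurable F)
    (s : ℝ) (x : ℝ≥0∞) :
    ∫⁻ ω, F (s + arrival ω.1 0, ω.2 0, x + pointSum φ s ω) ∂jointLaw Q
      = ∫⁻ ω, ∫⁻ t, (if s + gapSum ω.1 0 ≤ t ∧ t < s + gapSum ω.1 1 then
          addPoint Q φ F (t, x + pointSum φ s ω) else 0) ∂volume ∂jointLaw Q := by
  have hA := measurable_addPoint Q hφ hF
  have hG : Measurable fun t => ∫⁻ ω, addPoint Q φ F (t, x + pointSum φ t ω) ∂jointLaw Q :=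
    Measurable.lintegral_prod_right' (f := fun p : ℝ × ((ℕ → ℝ) × (ℕ → 𝒵)) =>
      addPoint Q φ F (p.1, x + pointSum φ p.1 p.2)) (by fun_prop)
  have hl : ∫⁻ ω, F (s + arrival ω.1 0, ω.2 0, x + pointSum φ s ω) ∂jointLaw Q
      = ∫⁻ a, (fun t => ∫⁻ ω, addPoint Q φ F (t, x + pointSum φ t ω) ∂jointLaw Q) (s + a)
          ∂expMeasure 1 := by
    rw [lintegral_jointLaw Q (by fun_prop)]
    refine lintegral_congr fun a => ?_
    simp only [arrival_seqCons_zero, seqCons_zero, pointSum_seqCons, addPoint]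
    rw [lintegral_lintegral_swap (by fun_prop)]
    refine lintegral_congr fun ω => lintegral_congr fun z => ?_
    rw [add_comm (φ _), add_assoc]
  rw [hl, lintegral_expMeasure_add s hG, lintegral_lintegral_swap]
  · rw [setLIntegral_congr Ioi_ae_eq_Ici, ← lintegral_indicator measurableSet_Ici]
    refine lintegral_congr fun t => ?_
    simp only [gapSum_zero, add_zero, Set.indicator, Set.mem_Ici]
    split_ifs with h
    · rw [← lintegral_pointSum_memoryless Q hφ (H := fun y => addPoint Q φ F (t, x + y))
        (by fun_prop) h]
      refine lintegral_congr fun ω => ?_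
      simp [h, gapSum]
    · simp [h]
  · refine Measurable.aemeasurable (Measurable.ite ?_ (by fun_prop) measurable_const)
    exact measurableSet_between_gapSum s 0 1

/-- A point inserted between the sums of `k` and of `k + 1` gaps becomes the point of index `k`.
Conditioning on the first point shifts the start `s` and the accumulated total `x`, so the induction
runs over all values of both. -/
lemma lintegral_point (Q : Measure 𝒵) [IsProbabilityMeasure Q]
    {φ : ℝ × 𝒵 → ℝ≥0∞} (hφ : Measurable φ) {F : ℝ × 𝒵 × ℝ≥0∞ → ℝ≥0∞} (hF : Measurable F)
    (k : ℕ) (s : ℝ) (x : ℝ≥0∞) :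
    ∫⁻ ω, F (s + arrival ω.1 k, ω.2 k, x + pointSum φ s ω) ∂jointLaw Q
      = ∫⁻ ω, ∫⁻ t, (if s + gapSum ω.1 k ≤ t ∧ t < s + gapSum ω.1 (k + 1) then
          addPoint Q φ F (t, x + pointSum φ s ω) else 0) ∂volume ∂jointLaw Q := by
  induction k generalizing s x with
  | zero => exact lintegral_point_zero Q hφ hF s x
  | succ k ih =>
    have hA := measurable_addPoint Q hφ hF
    rw [lintegral_jointLaw Q (by fun_prop), lintegral_jointLaw Q]
    · refine lintegral_congr fun a => lintegral_congr fun z => ?_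
      simp only [arrival_seqCons_succ, seqCons_succ, pointSum_seqCons, gapSum_seqCons_succ,
        ← add_assoc]
      exact ih (s + a) (x + φ (s + a, z))
    · refine Measurable.lintegral_prod_right' (f := fun p : ((ℕ → ℝ) × (ℕ → 𝒵)) × ℝ =>
        if s + gapSum p.1.1 (k + 1) ≤ p.2 ∧ p.2 < s + gapSum p.1.1 (k + 1 + 1) then
          addPoint Q φ F (p.2, x + pointSum φ s p.1) else 0)
          (Measurable.ite (measurableSet_between_gapSum s _ _) (by fun_prop) measurable_const)

lemma ae_gap_nonneg : ∀ᵐ e ∂gapLaw, ∀ i, 0 ≤ e i := by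
  refine ae_all_iff.2 fun i => ?_
  have hmp : MeasurePreserving (fun e : ℕ → ℝ => e i) gapLaw (expMeasure 1) :=
    measurePreserving_eval_infinitePi (fun _ : ℕ => expMeasure 1) i
  have h : ∀ᵐ a ∂expMeasure 1, 0 ≤ a := by
    have h0 := lintegral_expMeasure_add 0 (f := Set.indicator (Set.Iio 0) 1)
      (measurable_one.indicator measurableSet_Iio)
    simp only [zero_add] at h0
    rw [lintegral_indicator_one measurableSet_Iio] at h0
    rw [ae_iff]
    have : {a : ℝ | ¬ 0 ≤ a} = Set.Iio 0 := by ext; simp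
    rw [this, h0]
    refine (setLIntegral_congr_fun measurableSet_Ioi (g := fun _ => 0) fun t ht => ?_).trans
      (by simp)
    simp [not_lt.2 (le_of_lt (Set.mem_Ioi.1 ht))]
  exact hmp.quasiMeasurePreserving.ae h

lemma lintegral_exp_neg_gapSum (k : ℕ) :
    ∫⁻ e, ENNReal.ofReal (Real.exp (-gapSum e k)) ∂gapLaw = (2⁻¹ : ℝ≥0∞) ^ k := by
  induction k with
  | zero => simp [gapSum_zero]
  | succ k ih =>
    have h1 : gapLaw = ((expMeasure 1).prod gapLaw).map (fun p => seqCons p.1 p.2) :=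
      (map_seqCons _).symm
    have hexp : ∫⁻ a, ENNReal.ofReal (Real.exp (-a)) ∂expMeasure 1 = 2⁻¹ := by
      have h0 := lintegral_expMeasure_add 0 (f := fun a => ENNReal.ofReal (Real.exp (-a)))
        (by fun_prop)
      simp only [zero_add, zero_sub] at h0
      rw [h0]
      have : ∀ t : ℝ, ENNReal.ofReal (Real.exp (-t)) * ENNReal.ofReal (Real.exp (-t))
          = ENNReal.ofReal (Real.exp (-2 * t)) := fun t => by
        rw [← ENNReal.ofReal_mul (Real.exp_nonneg _), ← Real.exp_add]
        ring_nf
      simp_rw [this]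
      rw [← ofReal_integral_eq_lintegral_ofReal
        (integrableOn_exp_mul_Ioi (by norm_num) 0)
        (ae_of_all _ fun t => Real.exp_nonneg _), integral_exp_mul_Ioi (by norm_num)]
      rw [← ENNReal.ofReal_ofNat, ← ENNReal.ofReal_inv_of_pos (by norm_num)]
      norm_num
    conv_lhs => rw [h1]
    rw [lintegral_map (by fun_prop) (by fun_prop), lintegral_prod _ (by fun_prop)]
    simp only [gapSum_seqCons_succ, neg_add, Real.exp_add,
      ENNReal.ofReal_mul (Real.exp_nonneg _)]
    simp_rw [lintegral_const_mul _ (f := fun e : ℕ → ℝ => ENNReal.ofReal (Real.exp (-gapSum e k)))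
      (by fun_prop), ih]
    rw [lintegral_mul_const _ (by fun_prop), hexp, pow_succ, mul_comm]

/-- The variables exp (-`gapSum e k`) have means 2^(-k), which are summable, so almost surely they
tend to 0. This ensures that the insertion intervals cover the whole half-line. -/
lemma ae_tendsto_gapSum : ∀ᵐ e ∂gapLaw, Filter.Tendsto (gapSum e) Filter.atTop Filter.atTop := by
  have h : ∫⁻ e, ∑' k, ENNReal.ofReal (Real.exp (-gapSum e k)) ∂gapLaw ≠ ∞ := by
    rw [lintegral_tsum (fun k => by fun_prop)]
    simp_rw [lintegral_exp_neg_gapSum]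
    rw [ENNReal.tsum_geometric]
    simp
  filter_upwards [ae_lt_top (Measurable.tsum fun k => by fun_prop) h] with e he
  have h0 := ENNReal.tendsto_atTop_zero_of_tsum_ne_top he.ne
  have h1 : Filter.Tendsto (fun k => Real.exp (-gapSum e k)) Filter.atTop (nhds 0) := by
    have := (ENNReal.tendsto_toReal ENNReal.zero_ne_top).comp h0
    simpa only [Function.comp_def, ENNReal.toReal_ofReal (Real.exp_nonneg _),
      ENNReal.toReal_zero] using this
  have := Real.tendsto_exp_comp_nhds_zero.1 h1
  simpa using Filter.tendsto_neg_atBot_iff.1 this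

/-- The Mecke equation for functionals of a point and of the total `pointSum φ`. -/
theorem mecke (Q : Measure 𝒵) [IsProbabilityMeasure Q]
    {φ : ℝ × 𝒵 → ℝ≥0∞} (hφ : Measurable φ) {F : ℝ × 𝒵 × ℝ≥0∞ → ℝ≥0∞} (hF : Measurable F) :
    ∫⁻ ω, ∑' k, F (arrival ω.1 k, ω.2 k, pointSum φ 0 ω) ∂jointLaw Q
      = ∫⁻ z, ∫⁻ t in Set.Ioi (0 : ℝ), ∫⁻ ω, F (t, z, pointSum φ 0 ω + φ (t, z)) ∂jointLaw Q
          ∂volume ∂Q := by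
  have hA := measurable_addPoint Q hφ hF
  have hk : ∀ k, ∫⁻ ω, F (arrival ω.1 k, ω.2 k, pointSum φ 0 ω) ∂jointLaw Q
      = ∫⁻ ω, ∫⁻ t, (if gapSum ω.1 k ≤ t ∧ t < gapSum ω.1 (k + 1) then
          addPoint Q φ F (t, pointSum φ 0 ω) else 0) ∂volume ∂jointLaw Q := fun k => by
    simpa only [zero_add] using lintegral_point Q hφ hF k 0 0
  rw [lintegral_tsum (fun k => by fun_prop)]
  simp_rw [hk]
  rw [← lintegral_tsum fun k => Measurable.aemeasurable <|
    Measurable.lintegral_prod_right' (f := fun p : ((ℕ → ℝ) × (ℕ → 𝒵)) × ℝ =>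
      if gapSum p.1.1 k ≤ p.2 ∧ p.2 < gapSum p.1.1 (k + 1) then
        addPoint Q φ F (p.2, pointSum φ 0 p.1) else 0)
      (Measurable.ite (by simpa using measurableSet_between_gapSum (𝒵 := 𝒵) 0 k (k + 1))
        (by fun_prop) measurable_const)]
  have hsum : ∀ᵐ ω ∂jointLaw Q, ∑' k, ∫⁻ t, (if gapSum ω.1 k ≤ t ∧ t < gapSum ω.1 (k + 1) then
          addPoint Q φ F (t, pointSum φ 0 ω) else 0)
        = ∫⁻ t in Set.Ioi 0, addPoint Q φ F (t, pointSum φ 0 ω) := by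
    have hfst : Measure.QuasiMeasurePreserving
        (Prod.fst : (ℕ → ℝ) × (ℕ → 𝒵) → ℕ → ℝ) (jointLaw Q) gapLaw :=
      Measure.quasiMeasurePreserving_fst
    filter_upwards [hfst.ae ae_gap_nonneg, hfst.ae ae_tendsto_gapSum] with ω h0 hlim
    have hmono : Monotone (gapSum ω.1) := monotone_nat_of_le_succ fun k => by
      simp only [gapSum, Finset.sum_range_succ]
      linarith [h0 k]
    -- The insertion intervals of the different indices tile [0, ∞), so summing over `k` leaves an
    -- unrestricted integral over the insertion time.
    have hU : ⋃ k, Set.Ico (gapSum ω.1 k) (gapSum ω.1 (k + 1)) = Set.Ici 0 := by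
      have := iUnion_Ico_map_succ_eq_Ici (f := gapSum ω.1) (fun k => hmono bot_le)
        (Filter.not_bddAbove_of_tendsto_atTop hlim)
      simpa [gapSum_zero] using this
    rw [setLIntegral_congr Ioi_ae_eq_Ici, ← hU]
    refine Eq.trans ?_ (lintegral_iUnion (fun _ => measurableSet_Ico)
      hmono.pairwise_disjoint_on_Ico_succ _).symm
    refine tsum_congr fun k => ?_
    rw [← lintegral_indicator measurableSet_Ico]
    simp only [Set.indicator, Set.mem_Ico, Order.succ_eq_add_one]
  rw [lintegral_congr_ae hsum, lintegral_lintegral_swap (by fun_prop)]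
  have hsw : ∀ t, ∫⁻ ω, addPoint Q φ F (t, pointSum φ 0 ω) ∂jointLaw Q
      = ∫⁻ z, ∫⁻ ω, F (t, z, pointSum φ 0 ω + φ (t, z)) ∂jointLaw Q ∂Q := fun t => by
    simp only [addPoint]
    rw [lintegral_lintegral_swap (by fun_prop)]
  simp_rw [hsw]
  rw [lintegral_lintegral_swap]
  exact Measurable.aemeasurable <| Measurable.lintegral_prod_right'
    (f := fun p : (ℝ × 𝒵) × ((ℕ → ℝ) × (ℕ → 𝒵)) =>
      F (p.1.1, p.1.2, pointSum φ 0 p.2 + φ (p.1.1, p.1.2))) (by fun_prop)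

/-! ### The scaled times as a Poisson process of rate 1 -/

/-- A linear substitution. The value at ∞ matters when `c = 0`: the argument is then ∞ for every t >
0, and `hH0` makes the integral vanish. -/
lemma lintegral_Ioi_comp_mul_inv {H : ℝ≥0∞ → ℝ≥0∞} (hH : Measurable H) (hH0 : H ∞ = 0)
    {c : ℝ≥0∞} (hc : c ≠ ∞) :
    ∫⁻ t in Set.Ioi (0 : ℝ), H (ENNReal.ofReal t * c⁻¹)
      = c * ∫⁻ t in Set.Ioi (0 : ℝ), H (ENNReal.ofReal t) := by
  rcases eq_or_ne c 0 with rfl | hc0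
  · rw [zero_mul]
    refine (setLIntegral_congr_fun measurableSet_Ioi (g := fun _ => 0) fun t ht => ?_).trans
      (by simp)
    simp only [ENNReal.inv_zero]
    rw [ENNReal.mul_top (by simpa using ht), hH0]
  · have hr : 0 < c.toReal := ENNReal.toReal_pos hc0 hc
    have hmap := Real.smul_map_volume_mul_left (inv_pos.2 hr).ne'
    have h2 : ∀ t : ℝ, 0 < t → ENNReal.ofReal t * c⁻¹ = ENNReal.ofReal (c.toReal⁻¹ * t) := by
      intro t ht
      rw [mul_comm, ENNReal.ofReal_mul (inv_pos.2 hr).le, ENNReal.ofReal_inv_of_pos hr,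
        ENNReal.ofReal_toReal hc]
    rw [← lintegral_indicator measurableSet_Ioi, ← lintegral_indicator measurableSet_Ioi]
    conv_rhs => rw [← hmap]
    have hHm : Measurable fun t => (Set.Ioi (0 : ℝ)).indicator (fun t => H (ENNReal.ofReal t)) t :=
      (hH.comp ENNReal.measurable_ofReal).indicator measurableSet_Ioi
    rw [lintegral_smul_measure, lintegral_map hHm (by fun_prop),
      abs_of_pos (inv_pos.2 hr), ENNReal.ofReal_inv_of_pos hr, ENNReal.ofReal_toReal hc,
      smul_eq_mul, ← mul_assoc, ENNReal.mul_inv_cancel hc0 hc, one_mul]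
    refine lintegral_congr fun t => ?_
    simp only [Set.indicator, Set.mem_Ioi]
    by_cases ht : 0 < t
    · rw [if_pos ht, if_pos (by positivity), h2 t ht]
    · rw [if_neg ht, if_neg]
      rw [not_lt] at ht ⊢
      exact mul_nonpos_of_nonneg_of_nonpos (inv_pos.2 hr).le ht

@[fun_prop]
lemma measurable_scaledTime (Q P : Measure 𝒵) (i : ℕ) :
    Measurable fun ω => scaledTime Q P ω i := by
  have : Measurable fun ω : (ℕ → ℝ) × (ℕ → 𝒵) => P.rnDeriv Q (ω.2 i) :=
    (Measure.measurable_rnDeriv P Q).comp (by fun_prop)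
  unfold scaledTime
  fun_prop

/-- The Mecke equation for the scaled times. -/
theorem mecke_scaledTime (Q P : Measure 𝒵) [IsProbabilityMeasure Q] [IsProbabilityMeasure P]
    (hPQ : P ≪ Q) {h : 𝒵 → ℝ≥0∞} (hh : Measurable h) {K : ℝ≥0∞ → ℝ≥0∞} (hK : Measurable K)
    {G : ℝ≥0∞ × ℝ≥0∞ → ℝ≥0∞} (hG : Measurable G) (hG0 : ∀ y, G (∞, y) = 0) :
    ∫⁻ ω, ∑' k, h (ω.2 k) * G (scaledTime Q P ω k, ∑' i, K (scaledTime Q P ω i)) ∂jointLaw Q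
      = (∫⁻ z, h z ∂P) * ∫⁻ t in Set.Ioi (0 : ℝ), ∫⁻ ω,
          G (ENNReal.ofReal t, ∑' i, K (scaledTime Q P ω i) + K (ENNReal.ofReal t)) ∂jointLaw Q := by
  have hf := Measure.measurable_rnDeriv P Q
  have hm := mecke Q (φ := fun p => K (ENNReal.ofReal p.1 * (P.rnDeriv Q p.2)⁻¹)) (by fun_prop)
    (F := fun p => h p.2.1 * G (ENNReal.ofReal p.1 * (P.rnDeriv Q p.2.1)⁻¹, p.2.2)) (by fun_prop)
  simp only [pointSum, zero_add] at hm
  refine hm.trans ?_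
  change ∫⁻ z, ∫⁻ t in Set.Ioi (0 : ℝ), ∫⁻ ω, h z * G (ENNReal.ofReal t * (P.rnDeriv Q z)⁻¹,
    ∑' i, K (scaledTime Q P ω i) + K (ENNReal.ofReal t * (P.rnDeriv Q z)⁻¹)) ∂jointLaw Q
      ∂volume ∂Q = _
  -- The integrand sees the time and the mark only through `h z` and `J` at the scaled time.
  -- Substituting in time gives the factor dP/dQ (z), which turns Q into P and leaves a time
  -- integral free of `z`.
  set J : ℝ≥0∞ → ℝ≥0∞ := fun u =>
    ∫⁻ ω, G (u, ∑' i, K (scaledTime Q P ω i) + K u) ∂jointLaw Q with hJ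
  have hX : Measurable fun ω => ∑' i, K (scaledTime Q P ω i) :=
    Measurable.tsum fun i => by fun_prop
  have hJm : Measurable J := Measurable.lintegral_prod_right'
    (f := fun p : ℝ≥0∞ × ((ℕ → ℝ) × (ℕ → 𝒵)) =>
      G (p.1, ∑' i, K (scaledTime Q P p.2 i) + K p.1)) (by fun_prop)
  have hJ0 : J ∞ = 0 := by simp [hJ, hG0]
  rw [← lintegral_rnDeriv_mul hPQ hh.aemeasurable, ← lintegral_mul_const _ (by fun_prop)]
  refine lintegral_congr_ae ?_
  filter_upwards [Measure.rnDeriv_lt_top P Q] with z hz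
  have h1 : ∀ t, ∫⁻ ω, h z * G (ENNReal.ofReal t * (P.rnDeriv Q z)⁻¹,
      ∑' i, K (scaledTime Q P ω i) + K (ENNReal.ofReal t * (P.rnDeriv Q z)⁻¹)) ∂jointLaw Q
      = h z * J (ENNReal.ofReal t * (P.rnDeriv Q z)⁻¹) := fun t => by
    rw [lintegral_const_mul _ (by fun_prop)]
  simp_rw [h1]
  rw [lintegral_const_mul _ (by fun_prop), lintegral_Ioi_comp_mul_inv hJm hJ0 hz.ne, ← mul_assoc,
    mul_comm (h z)]

/-- The mark of the selected point has law `P`, up to the possible failure of the normalisation. -/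
lemma lintegral_select_le (Q P : Measure 𝒵) [IsProbabilityMeasure Q] [IsProbabilityMeasure P]
    (hPQ : P ≪ Q) {α : ℝ} (hα : 0 < α) {h : 𝒵 → ℝ≥0∞} (hh : Measurable h) :
    ∫⁻ ω, ∑' k, h (ω.2 k) * indexProb α Q P ω k ∂jointLaw Q ≤ ∫⁻ z, h z ∂P := by
  have key := fun (g : 𝒵 → ℝ≥0∞) (hg : Measurable g) =>
    mecke_scaledTime Q P hPQ hg (K := fun u => u ^ (-α)) (by fun_prop)
      (G := fun p => p.1 ^ (-α) / p.2) (by fun_prop)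
      (fun y => by simp [ENNReal.top_rpow_of_neg (y := -α) (by linarith)])
  -- The second factor in `key` does not depend on `g`. Taking the constant 1 bounds it by the total
  -- index probability, hence by 1, without knowing that the total weight is positive and finite.
  have h1 := key 1 measurable_one
  have hle : ∫⁻ ω, ∑' k, (1 : 𝒵 → ℝ≥0∞) (ω.2 k) *
      (scaledTime Q P ω k ^ (-α) / ∑' i, scaledTime Q P ω i ^ (-α)) ∂jointLaw Q ≤ 1 := by
    calc _ ≤ ∫⁻ ω, 1 ∂jointLaw Q := lintegral_mono fun ω => by
          simp only [Pi.one_apply, one_mul, div_eq_mul_inv, ENNReal.tsum_mul_right]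
          exact ENNReal.mul_inv_le_one _
      _ = 1 := by simp
  rw [h1] at hle
  simp only [Pi.one_apply, lintegral_one, measure_univ, one_mul] at hle
  exact (key h hh).trans_le (mul_le_of_le_one_right' hle)

/-- Campbell's formula for the scaled times. -/
lemma lintegral_tsum_scaledTime (Q P : Measure 𝒵) [IsProbabilityMeasure Q]
    [IsProbabilityMeasure P] (hPQ : P ≪ Q) {K : ℝ≥0∞ → ℝ≥0∞} (hK : Measurable K)
    (hK0 : K ∞ = 0) :
    ∫⁻ ω, ∑' k, K (scaledTime Q P ω k) ∂jointLaw Q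
      = ∫⁻ t in Set.Ioi (0 : ℝ), K (ENNReal.ofReal t) := by
  simpa using mecke_scaledTime Q P hPQ (h := 1) measurable_one hK
    (G := fun p => K p.1) (by fun_prop) (fun _ => hK0)

/-- One factor of the square is read as a sum over points and the other as the total. The inserted
point's own contribution to the total yields ∫ K², which is the variance. -/
lemma lintegral_tsum_scaledTime_sq (Q P : Measure 𝒵) [IsProbabilityMeasure Q]
    [IsProbabilityMeasure P] (hPQ : P ≪ Q) {K : ℝ≥0∞ → ℝ≥0∞} (hK : Measurable K)
    (hK0 : K ∞ = 0) :
    ∫⁻ ω, (∑' k, K (scaledTime Q P ω k)) ^ 2 ∂jointLaw Q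
      = (∫⁻ t in Set.Ioi (0 : ℝ), K (ENNReal.ofReal t)) ^ 2
        + ∫⁻ t in Set.Ioi (0 : ℝ), K (ENNReal.ofReal t) ^ 2 := by
  have h := mecke_scaledTime Q P hPQ (h := 1) measurable_one hK
    (G := fun p => K p.1 * p.2) (by fun_prop) (fun _ => by simp [hK0])
  have hX : Measurable fun ω => ∑' i, K (scaledTime Q P ω i) :=
    Measurable.tsum fun i => by fun_prop
  simp only [Pi.one_apply, one_mul, lintegral_one, measure_univ, ENNReal.tsum_mul_right] at h
  simp_rw [sq]
  rw [h]
  have h2 : ∀ t : ℝ, ∫⁻ ω, K (ENNReal.ofReal t)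
      * (∑' i, K (scaledTime Q P ω i) + K (ENNReal.ofReal t)) ∂jointLaw Q
      = K (ENNReal.ofReal t) * (∫⁻ t in Set.Ioi (0 : ℝ), K (ENNReal.ofReal t))
        + K (ENNReal.ofReal t) * K (ENNReal.ofReal t) := fun t => by
    rw [lintegral_const_mul _ (by fun_prop), lintegral_add_right _ measurable_const,
      lintegral_tsum_scaledTime Q P hPQ hK hK0, mul_add]
    simp
  simp_rw [h2]
  rw [lintegral_add_right _ (by fun_prop), lintegral_mul_const _ (by fun_prop)]

/-! ### Concentration of the total weight -/

/-- Chebyshev's inequality for the relative deviation of an `ℝ≥0∞`-valued random variable. -/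
lemma measure_relative_deviation_le {Ω : Type*} [MeasurableSpace Ω] (μ : Measure Ω)
    [IsProbabilityMeasure μ] {X : Ω → ℝ≥0∞} (hX : Measurable X) {m v η : ℝ} (hm : 0 < m)
    (hv : 0 ≤ v) (hη : 0 < η) (h1 : ∫⁻ ω, X ω ∂μ = ENNReal.ofReal m)
    (h2 : ∫⁻ ω, X ω ^ 2 ∂μ = ENNReal.ofReal (m ^ 2 + v)) :
    μ {ω | ¬ (ENNReal.ofReal ((1 - η) * m) ≤ X ω ∧ X ω ≤ ENNReal.ofReal ((1 + η) * m))}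
      ≤ ENNReal.ofReal (v / (η * m) ^ 2) := by
  have hfin : ∀ᵐ ω ∂μ, X ω < ∞ := ae_lt_top hX (by rw [h1]; exact ENNReal.ofReal_ne_top)
  have hsq : ∀ ω, X ω ^ 2 = ENNReal.ofReal ((X ω).toReal ^ 2) ∨ X ω = ∞ := fun ω => by
    by_cases h : X ω = ∞
    · exact Or.inr h
    · left
      rw [ENNReal.ofReal_pow ENNReal.toReal_nonneg, ENNReal.ofReal_toReal h]
  have hmean : ∫ ω, (X ω).toReal ∂μ = m := by
    rw [integral_toReal hX.aemeasurable hfin, h1, ENNReal.toReal_ofReal hm.le]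
  have hmean2 : ∫ ω, (X ω).toReal ^ 2 ∂μ = m ^ 2 + v := by
    have : ∀ ω, (X ω).toReal ^ 2 = (X ω ^ 2).toReal := fun ω => (ENNReal.toReal_pow _ _).symm
    simp_rw [this]
    rw [integral_toReal (by fun_prop) (hfin.mono fun ω h => ENNReal.pow_lt_top h), h2,
      ENNReal.toReal_ofReal (by positivity)]
  have hL : MemLp (fun ω => (X ω).toReal) 2 μ := by
    rw [memLp_two_iff_integrable_sq hX.ennreal_toReal.aestronglyMeasurable]
    have : ∀ ω, (X ω).toReal ^ 2 = (X ω ^ 2).toReal := fun ω => (ENNReal.toReal_pow _ _).symm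
    simp_rw [this]
    exact integrable_toReal_of_lintegral_ne_top (by fun_prop)
      (by rw [h2]; exact ENNReal.ofReal_ne_top)
  have hvar : variance (fun ω => (X ω).toReal) μ = v := by
    rw [variance_eq_sub hL, hmean]
    simp only [Pi.pow_apply]
    rw [hmean2]
    ring
  have hch := meas_ge_le_variance_div_sq hL (c := η * m) (by positivity)
  rw [hvar, hmean] at hch
  refine (measure_mono_ae ?_).trans hch
  filter_upwards [hfin] with ω hω hbad
  change η * m ≤ |(X ω).toReal - m|
  by_contra hlt
  rw [not_le, abs_lt] at hlt
  refine hbad ⟨?_, ?_⟩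
  · exact ENNReal.ofReal_le_of_le_toReal (by linarith)
  · rw [ENNReal.le_ofReal_iff_toReal_le hω.ne (by positivity)]
    linarith

/-- The contribution of a scaled time beyond the threshold `τ`. -/
noncomputable def truncWeight (α τ : ℝ) (u : ℝ≥0∞) : ℝ≥0∞ :=
  if u ≤ ENNReal.ofReal τ then 0 else u ^ (-α)

@[fun_prop]
lemma measurable_truncWeight (α τ : ℝ) : Measurable (truncWeight α τ) :=
  Measurable.ite measurableSet_Iic measurable_const (by fun_prop)

lemma truncWeight_top {α : ℝ} (hα : 0 < α) (τ : ℝ) : truncWeight α τ ∞ = 0 := by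
  simp [truncWeight, ENNReal.top_rpow_of_neg (y := -α) (by linarith)]

lemma truncWeight_sq {α τ : ℝ} (u : ℝ≥0∞) : truncWeight α τ u ^ 2 = truncWeight (2 * α) τ u := by
  unfold truncWeight
  split_ifs
  · simp
  · rw [← ENNReal.rpow_natCast, ← ENNReal.rpow_mul]
    congr 1
    push_cast
    ring

lemma lintegral_truncWeight {α τ : ℝ} (hα : 1 < α) (hτ : 0 < τ) :
    ∫⁻ t in Set.Ioi (0 : ℝ), truncWeight α τ (ENNReal.ofReal t)
      = ENNReal.ofReal (τ ^ (1 - α) / (α - 1)) := by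
  have h1 : ∫⁻ t in Set.Ioi (0 : ℝ), truncWeight α τ (ENNReal.ofReal t)
      = ∫⁻ t in Set.Ioi τ, ENNReal.ofReal (t ^ (-α)) := by
    rw [← lintegral_indicator measurableSet_Ioi, ← lintegral_indicator measurableSet_Ioi]
    refine lintegral_congr fun t => ?_
    simp only [Set.indicator, Set.mem_Ioi, truncWeight]
    by_cases h : τ < t
    · have h0 := hτ.trans h
      rw [if_pos h0, if_pos h, if_neg (by rw [ENNReal.ofReal_le_ofReal_iff hτ.le]; linarith),
        ENNReal.ofReal_rpow_of_pos h0]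
    · rw [if_neg h, if_pos (ENNReal.ofReal_le_ofReal (not_lt.1 h)), ite_self]
  rw [h1, ← ofReal_integral_eq_lintegral_ofReal (integrableOn_Ioi_rpow_of_lt (by linarith) hτ)
    ((ae_restrict_iff' measurableSet_Ioi).2 <| ae_of_all _ fun t ht =>
      Real.rpow_nonneg (hτ.trans ht).le _), integral_Ioi_rpow_of_lt (by linarith) hτ]
  congr 1
  rw [show -α + 1 = -(α - 1) by ring, show 1 - α = -(α - 1) by ring, div_neg, neg_div, neg_neg]

/-- The total weight beyond `τ` concentrates around its mean. -/
lemma measure_truncWeight_deviation_le (Q P : Measure 𝒵) [IsProbabilityMeasure Q]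
    [IsProbabilityMeasure P] (hPQ : P ≪ Q) {α τ η : ℝ} (hα : 1 < α) (hτ : 0 < τ) (hη : 0 < η) :
    jointLaw Q {ω | ¬ (ENNReal.ofReal ((1 - η) * (τ ^ (1 - α) / (α - 1)))
        ≤ ∑' i, truncWeight α τ (scaledTime Q P ω i) ∧
        ∑' i, truncWeight α τ (scaledTime Q P ω i)
          ≤ ENNReal.ofReal ((1 + η) * (τ ^ (1 - α) / (α - 1))))}
      ≤ ENNReal.ofReal ((α - 1) ^ 2 / (η ^ 2 * τ)) := by
  have hX : Measurable fun ω => ∑' i, truncWeight α τ (scaledTime Q P ω i) :=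
    Measurable.tsum fun i => by fun_prop
  have hα1 : 0 < α - 1 := by linarith
  have hpow := Real.rpow_pos_of_pos hτ (1 - α)
  have hK0 := truncWeight_top (by linarith : 0 < α) τ
  have h1 := lintegral_tsum_scaledTime Q P hPQ (measurable_truncWeight α τ) hK0
  have h2 := lintegral_tsum_scaledTime_sq Q P hPQ (measurable_truncWeight α τ) hK0
  simp_rw [truncWeight_sq] at h2
  rw [lintegral_truncWeight hα hτ] at h1 h2
  rw [lintegral_truncWeight (by linarith) hτ, ← ENNReal.ofReal_pow (by positivity),
    ← ENNReal.ofReal_add (by positivity)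
      (div_nonneg (Real.rpow_nonneg hτ.le _) (by linarith))] at h2
  refine (measure_relative_deviation_le _ hX (by positivity)
    (div_nonneg (Real.rpow_nonneg hτ.le _) (by linarith)) hη h1 h2).trans
    (ENNReal.ofReal_le_ofReal ?_)
  -- The variance τ^(1 - 2α) / (2α - 1) is rewritten through the mean, so that powers of τ cancel in
  -- the Chebyshev bound up to a single 1 / τ.
  have hp : τ ^ (1 - 2 * α) = (τ ^ (1 - α)) ^ 2 / τ := by
    rw [show 1 - 2 * α = (1 - α) + (1 - α) - 1 by ring, Real.rpow_sub_one hτ.ne',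
      Real.rpow_add hτ, sq]
  rw [hp]
  have : (τ ^ (1 - α)) ^ 2 / τ / (2 * α - 1) / (η * (τ ^ (1 - α) / (α - 1))) ^ 2
      = (α - 1) ^ 2 / (η ^ 2 * τ) / (2 * α - 1) := by
    have : 2 * α - 1 ≠ 0 := by linarith
    field_simp
  rw [this]
  exact div_le_self (by positivity) (by linarith)

/-- Union bound: by Campbell's formula the expected number of scaled times up to τ is τ. -/
lemma measure_exists_scaledTime_le (Q P : Measure 𝒵) [IsProbabilityMeasure Q]
    [IsProbabilityMeasure P] (hPQ : P ≪ Q) {τ : ℝ} (hτ : 0 < τ) :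
    jointLaw Q {ω | ∃ i, scaledTime Q P ω i ≤ ENNReal.ofReal τ} ≤ ENNReal.ofReal τ := by
  have hK : Measurable fun u : ℝ≥0∞ => (Set.Iic (ENNReal.ofReal τ)).indicator (1 : ℝ≥0∞ → ℝ≥0∞) u :=
    measurable_one.indicator measurableSet_Iic
  have hKi : ∀ i, AEMeasurable (fun ω =>
      (Set.Iic (ENNReal.ofReal τ)).indicator (1 : ℝ≥0∞ → ℝ≥0∞) (scaledTime Q P ω i)) (jointLaw Q) :=
    fun i => (hK.comp (measurable_scaledTime Q P i)).aemeasurable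
  have hi : ∀ i, jointLaw Q {ω | scaledTime Q P ω i ≤ ENNReal.ofReal τ}
      = ∫⁻ ω, (Set.Iic (ENNReal.ofReal τ)).indicator (1 : ℝ≥0∞ → ℝ≥0∞) (scaledTime Q P ω i) ∂jointLaw Q :=
    fun i => (lintegral_indicator_one
      (measurableSet_le (measurable_scaledTime Q P i) measurable_const)).symm
  rw [Set.ofPred_exists]
  refine (measure_iUnion_le _).trans ?_
  simp_rw [hi]
  rw [← lintegral_tsum hKi,
    lintegral_tsum_scaledTime Q P hPQ hK (by simp), ← lintegral_indicator measurableSet_Ioi]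
  have hind : ∀ t : ℝ, (Set.Ioi (0 : ℝ)).indicator
      (fun t => (Set.Iic (ENNReal.ofReal τ)).indicator (1 : ℝ≥0∞ → ℝ≥0∞) (ENNReal.ofReal t)) t
      = (Set.Ioc 0 τ).indicator 1 t := fun t => by
    simp only [Set.indicator, Set.mem_Ioi, Set.mem_Iic, Set.mem_Ioc,
      ENNReal.ofReal_le_ofReal_iff hτ.le, ite_and, Pi.one_apply]
  simp_rw [hind]
  rw [lintegral_indicator_one measurableSet_Ioc]
  simp

/-! ### Comparison of the two laws on common gaps and samples -/

lemma law_apply (α : ℝ) (Q P : Measure 𝒵) [IsProbabilityMeasure Q] {S : Set ((ℕ → 𝒵) × ℕ)}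
    (hS : MeasurableSet S) :
    law α Q P S = ∫⁻ ω, ∑' k, S.indicator 1 (ω.2, k) * indexProb α Q P ω k ∂jointLaw Q := by
  have hm : Measurable fun p : ((ℕ → ℝ) × (ℕ → 𝒵)) × ℕ => (p.1.2, p.2) := by fun_prop
  rw [law, Measure.map_apply hm hS, Measure.compProd_apply (hm hS)]
  refine lintegral_congr fun ω => ?_
  change (Measure.sum fun k => indexProb α Q P ω k • Measure.dirac k) _ = _
  rw [Measure.sum_apply _ MeasurableSet.of_discrete]
  refine tsum_congr fun k => ?_
  rw [Measure.smul_apply, Measure.dirac_apply' _ MeasurableSet.of_discrete, smul_eq_mul, mul_comm]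
  rfl

/-- For x < 1, Bernoulli gives x^α ≥ 1 - α (1 - x), and α ≤ 2. For x ≥ 1 the power alone suffices
and the truncated difference is 0. -/
lemma one_le_rpow_add_two_mul_one_sub {α : ℝ} (hα : 1 ≤ α) (hα2 : α ≤ 2) (x : ℝ≥0∞) :
    1 ≤ x ^ α + 2 * (1 - x) := by
  rcases le_or_gt 1 x with h | h
  · exact (ENNReal.one_le_rpow h (by linarith)).trans le_self_add
  · lift x to NNReal using h.ne_top
    have hx : (x : ℝ) < 1 := by exact_mod_cast h
    have hb := one_add_mul_self_le_rpow_one_add (s := (x : ℝ) - 1)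
      (by linarith [x.coe_nonneg]) hα
    rw [add_sub_cancel] at hb
    have hr : (1 : ℝ) ≤ (x : ℝ) ^ α + 2 * (1 - x) := by nlinarith
    have hle : x ≤ 1 := by exact_mod_cast hx.le
    rw [← ENNReal.coe_rpow_of_nonneg _ (by linarith)]
    have : (1 : NNReal) ≤ x ^ α + 2 * (1 - x) := by
      rw [← NNReal.coe_le_coe]
      push_cast [NNReal.coe_sub hle]
      exact hr
    exact_mod_cast this

lemma weight_le {α : ℝ} (hα : 1 ≤ α) (hα2 : α ≤ 2) {a f g c : ℝ≥0∞} (ha : a ≠ ∞) (hc : c ≠ 0)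
    (hcT : c ≠ ∞) :
    (a * f⁻¹) ^ (-α) ≤ c ^ α * (a * g⁻¹) ^ (-α) + 2 * (1 - c * g / f) * (a * f⁻¹) ^ (-α) := by
  have hα0 : 0 < α := by linarith
  rcases eq_or_ne a 0 with rfl | ha0
  · have hcα : c ^ α ≠ 0 := by simp [ENNReal.rpow_eq_zero_iff, hc, hcT]
    rw [zero_mul, zero_mul, ENNReal.zero_rpow_of_neg (by linarith : -α < 0),
      ENNReal.mul_top hcα, top_add]
  · have hinv : ∀ y : ℝ≥0∞, (a * y⁻¹) ^ (-α) = (a⁻¹) ^ α * y ^ α := fun y => by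
      rw [ENNReal.rpow_neg, ← ENNReal.inv_rpow, ENNReal.mul_inv (Or.inl ha0) (Or.inl ha), inv_inv,
        ENNReal.mul_rpow_of_nonneg _ _ hα0.le]
    rw [hinv, hinv]
    calc (a⁻¹) ^ α * f ^ α ≤ ((a⁻¹) ^ α * f ^ α) *
          ((c * g / f) ^ α + 2 * (1 - c * g / f)) :=
          le_mul_of_one_le_right' (one_le_rpow_add_two_mul_one_sub hα hα2 _)
      _ = (a⁻¹) ^ α * (f * (c * g / f)) ^ α + 2 * (1 - c * g / f) * ((a⁻¹) ^ α * f ^ α) := by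
          rw [ENNReal.mul_rpow_of_nonneg _ _ hα0.le]
          ring
      _ ≤ (a⁻¹) ^ α * (c * g) ^ α + 2 * (1 - c * g / f) * ((a⁻¹) ^ α * f ^ α) := by
          -- Only f * (c g / f) ≤ c g is used, which also holds when `f` is 0 or ∞.
          gcongr _ * ?_ ^ α + _
          exact ENNReal.mul_div_le
      _ = _ := by
          rw [ENNReal.mul_rpow_of_nonneg _ _ hα0.le]
          ring

/-- The weight of the part of `P` that exceeds `c • P'`. -/
noncomputable def excess (c : ℝ≥0∞) (Q P P' : Measure 𝒵) (z : 𝒵) : ℝ≥0∞ :=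
  2 * (1 - c * P'.rnDeriv Q z / P.rnDeriv Q z)

lemma measurable_excess (c : ℝ≥0∞) (Q P P' : Measure 𝒵) : Measurable (excess c Q P P') := by
  have h1 := Measure.measurable_rnDeriv P Q
  have h2 := Measure.measurable_rnDeriv P' Q
  unfold excess
  fun_prop

/-- Against the density of P the excess becomes 2 (f - c g)₊, supported on A = {c g < f}. Its
integral is 2 (P(A) - c P'(A)), and the privacy bound is applied to this single set. -/
lemma lintegral_excess_le {c d : ℝ≥0∞} (hc : c ≠ ∞) (Q P P' : Measure 𝒵) [IsProbabilityMeasure Q]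
    [IsProbabilityMeasure P] [IsProbabilityMeasure P'] (hP : P ≪ Q) (hP' : P' ≪ Q)
    (hDP : ∀ S, MeasurableSet S → P S ≤ c * P' S + d) :
    ∫⁻ z, excess c Q P P' z ∂P ≤ 2 * d := by
  have h1 := Measure.measurable_rnDeriv P Q
  have h2 := Measure.measurable_rnDeriv P' Q
  set A : Set 𝒵 := {z | c * P'.rnDeriv Q z < P.rnDeriv Q z} with hA
  have hAm : MeasurableSet A := measurableSet_lt (by fun_prop) h1
  have hsubm : Measurable fun z =>
      A.indicator (fun z => P.rnDeriv Q z - c * P'.rnDeriv Q z) z :=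
    (h1.sub (by fun_prop)).indicator hAm
  rw [← lintegral_rnDeriv_mul hP (measurable_excess c Q P P').aemeasurable]
  calc ∫⁻ z, P.rnDeriv Q z * excess c Q P P' z ∂Q
      = ∫⁻ z, 2 * A.indicator (fun z => P.rnDeriv Q z - c * P'.rnDeriv Q z) z ∂Q := by
        refine lintegral_congr_ae ?_
        filter_upwards [Measure.rnDeriv_lt_top P Q] with z hz
        have : P.rnDeriv Q z * (1 - c * P'.rnDeriv Q z / P.rnDeriv Q z)
            = P.rnDeriv Q z - c * P'.rnDeriv Q z := by
          rcases eq_or_ne (P.rnDeriv Q z) 0 with h0 | h0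
          · simp [h0]
          · rw [ENNReal.mul_sub (fun _ _ => hz.ne), mul_one, ENNReal.mul_div_cancel h0 hz.ne]
        rw [excess, mul_left_comm, this]
        congr 1
        by_cases hz : z ∈ A
        · rw [Set.indicator_of_mem hz]
        · rw [Set.indicator_of_notMem hz, tsub_eq_zero_of_le (not_lt.1 hz)]
    _ = 2 * ∫⁻ z in A, P.rnDeriv Q z - c * P'.rnDeriv Q z ∂Q := by
        rw [lintegral_const_mul _ hsubm,
          lintegral_indicator hAm]
    _ = 2 * (P A - c * P' A) := by
        have hPA : ∫⁻ z in A, c * P'.rnDeriv Q z ∂Q = c * P' A := by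
          rw [lintegral_const_mul _ h2, Measure.setLIntegral_rnDeriv hP']
        rw [lintegral_sub (by fun_prop), hPA, Measure.setLIntegral_rnDeriv hP]
        · rw [hPA]
          exact ENNReal.mul_ne_top hc (measure_ne_top _ _)
        · exact (ae_restrict_iff' hAm).2 (ae_of_all _ fun z hz => le_of_lt hz)
    _ ≤ 2 * d := by
        gcongr
        exact tsub_le_iff_left.2 (hDP A hAm)

/-- The total weight under `P'` exceeds that under `P` by a large factor only rarely. -/
lemma measure_total_ratio_le (Q P P' : Measure 𝒵) [IsProbabilityMeasure Q]
    [IsProbabilityMeasure P] [IsProbabilityMeasure P'] (hP : P ≪ Q) (hP' : P' ≪ Q)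
    {α ε τ : ℝ} (hα : 1 < α) (hε0 : 0 < ε) (hε1 : ε ≤ 1) (hτ : 0 < τ)
    (hβ : α - 1 ≤ τ * ε ^ 2 / 32) (hτ1 : τ ≤ 1) :
    jointLaw Q {ω | ¬ ∑' i, scaledTime Q P' ω i ^ (-α)
      ≤ ENNReal.ofReal (Real.exp ε) * ∑' i, scaledTime Q P ω i ^ (-α)} ≤ ENNReal.ofReal (2 * τ) := by
  -- The choice of ε / 4 works because 1 + ε / 4 ≤ (1 + ε) (1 - ε / 4) for 0 < ε ≤ 1.
  have hη : 0 < ε / 4 := by linarith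
  -- Early points need excluding only for P': dropping them from the total under P still gives a
  -- lower bound. The failure probabilities are τ here and τ / 2 for each of the two deviations.
  have h1 := measure_exists_scaledTime_le Q P' hP' hτ
  have h2 := measure_truncWeight_deviation_le Q P hP hα hτ hη
  have h3 := measure_truncWeight_deviation_le Q P' hP' hα hτ hη
  have hd : (α - 1) ^ 2 / ((ε / 4) ^ 2 * τ) ≤ τ / 2 := by
    have : (α - 1) ^ 2 ≤ (τ * ε ^ 2 / 32) ^ 2 := pow_le_pow_left₀ (by linarith) hβ 2
    rw [div_le_iff₀ (by positivity)]
    have hε2 : ε ^ 2 ≤ 1 := pow_le_one₀ hε0.le hε1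
    have : (τ * ε ^ 2 / 32) ^ 2 ≤ τ ^ 2 * ε ^ 2 / 32 := by
      have h4 : 0 ≤ τ ^ 2 * ε ^ 2 := by positivity
      nlinarith [mul_le_mul_of_nonneg_left hε2 h4]
    nlinarith
  have hm : 0 < τ ^ (1 - α) / (α - 1) := div_pos (Real.rpow_pos_of_pos hτ _) (by linarith)
  set m := τ ^ (1 - α) / (α - 1)
  have hexp : (1 + ε / 4) * m ≤ Real.exp ε * ((1 - ε / 4) * m) := by
    rw [← mul_assoc]
    gcongr
    nlinarith [Real.add_one_le_exp ε, hε0, hε1]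
  refine (measure_mono ?_).trans ((measure_union_le _ _).trans
    ((add_le_add h1 ((measure_union_le _ _).trans (add_le_add h2 h3))).trans ?_))
  · intro ω hω
    by_contra hgood
    simp only [Set.mem_union, Set.mem_ofPred_eq, not_or, not_exists, not_not, not_le] at hgood
    obtain ⟨hg1, hg2, hg3⟩ := hgood
    refine hω ?_
    calc ∑' i, scaledTime Q P' ω i ^ (-α)
        = ∑' i, truncWeight α τ (scaledTime Q P' ω i) :=
          tsum_congr fun i => by rw [truncWeight, if_neg (not_le.2 (hg1 i))]
      _ ≤ ENNReal.ofReal ((1 + ε / 4) * m) := hg3.2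
      _ ≤ ENNReal.ofReal (Real.exp ε) * ENNReal.ofReal ((1 - ε / 4) * m) := by
          rw [← ENNReal.ofReal_mul (Real.exp_nonneg _)]
          exact ENNReal.ofReal_le_ofReal hexp
      _ ≤ ENNReal.ofReal (Real.exp ε) * ∑' i, scaledTime Q P ω i ^ (-α) := by
          gcongr
          refine hg2.1.trans (ENNReal.tsum_le_tsum fun i => ?_)
          unfold truncWeight
          split_ifs <;> simp
  · rw [← ENNReal.ofReal_add (by positivity) (by positivity),
      ← ENNReal.ofReal_add (by positivity) (by positivity)]
    exact ENNReal.ofReal_le_ofReal (by linarith)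

/-- The numerators cost `c ^ α` and the denominators cost `d`. The excess term keeps the denominator
belonging to `P`, so that `lintegral_select_le` can integrate it. -/
lemma indexProb_le {α : ℝ} (hα : 1 ≤ α) (hα2 : α ≤ 2) {c d : ℝ≥0∞} (hc : c ≠ 0) (hcT : c ≠ ∞)
    (hd : d ≠ 0) (hdT : d ≠ ∞) (Q P P' : Measure 𝒵) {ω : (ℕ → ℝ) × (ℕ → 𝒵)}
    (hω : ∑' i, scaledTime Q P' ω i ^ (-α) ≤ d * ∑' i, scaledTime Q P ω i ^ (-α)) (k : ℕ) :
    indexProb α Q P ω k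
      ≤ c ^ α * d * indexProb α Q P' ω k + excess c Q P P' (ω.2 k) * indexProb α Q P ω k := by
  unfold indexProb excess
  set W := ∑' i, scaledTime Q P ω i ^ (-α)
  set V := ∑' i, scaledTime Q P' ω i ^ (-α)
  have hinv : W⁻¹ ≤ d * V⁻¹ := by
    calc W⁻¹ = d * (d * W)⁻¹ := by
          rw [ENNReal.mul_inv (Or.inl hd) (Or.inl hdT), ← mul_assoc,
            ENNReal.mul_inv_cancel hd hdT, one_mul]
      _ ≤ d * V⁻¹ := by gcongr
  have hw := weight_le hα hα2 (a := ENNReal.ofReal (arrival ω.1 k)) (f := P.rnDeriv Q (ω.2 k))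
    (g := P'.rnDeriv Q (ω.2 k)) ENNReal.ofReal_ne_top hc hcT
  change scaledTime Q P ω k ^ (-α) ≤ c ^ α * scaledTime Q P' ω k ^ (-α)
    + 2 * (1 - c * P'.rnDeriv Q (ω.2 k) / P.rnDeriv Q (ω.2 k)) * scaledTime Q P ω k ^ (-α) at hw
  simp only [div_eq_mul_inv (_ ^ (-α))]
  calc scaledTime Q P ω k ^ (-α) * W⁻¹
      ≤ (c ^ α * scaledTime Q P' ω k ^ (-α) + 2 * (1 - c * P'.rnDeriv Q (ω.2 k) /
          P.rnDeriv Q (ω.2 k)) * scaledTime Q P ω k ^ (-α)) * W⁻¹ := by gcongr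
    _ = c ^ α * scaledTime Q P' ω k ^ (-α) * W⁻¹ + 2 * (1 - c * P'.rnDeriv Q (ω.2 k) /
          P.rnDeriv Q (ω.2 k)) * (scaledTime Q P ω k ^ (-α) * W⁻¹) := by ring
    _ ≤ c ^ α * scaledTime Q P' ω k ^ (-α) * (d * V⁻¹) + 2 * (1 - c * P'.rnDeriv Q (ω.2 k) /
          P.rnDeriv Q (ω.2 k)) * (scaledTime Q P ω k ^ (-α) * W⁻¹) := by gcongr
    _ = _ := by ring

theorem law_le {Q P P' : Measure 𝒵} [IsProbabilityMeasure Q]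
    [IsProbabilityMeasure P] [IsProbabilityMeasure P'] (hP : P ≪ Q) (hP' : P' ≪ Q)
    {α ε' δ' : ℝ} (hα : 1 < α) (hα2 : α ≤ 2) (hε0 : 0 < ε') (hε1 : ε' ≤ 1) (hδ0 : 0 < δ')
    (hδ1 : δ' ≤ 1) (hβ : α - 1 ≤ δ' * ε' ^ 2 / 32) {c d : ℝ≥0∞} (hc : c ≠ 0) (hcT : c ≠ ∞)
    (hDP : ∀ S, MeasurableSet S → P S ≤ c * P' S + d)
    {S : Set ((ℕ → 𝒵) × ℕ)} (hS : MeasurableSet S) :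
    law α Q P S ≤ c ^ α * ENNReal.ofReal (Real.exp ε') * law α Q P' S
      + (2 * d + ENNReal.ofReal (2 * δ')) := by
  set D := ENNReal.ofReal (Real.exp ε') with hD
  set B : Set ((ℕ → ℝ) × (ℕ → 𝒵)) := {ω | ¬ ∑' i, scaledTime Q P' ω i ^ (-α)
      ≤ D * ∑' i, scaledTime Q P ω i ^ (-α)} with hB
  have hBm : MeasurableSet B := by
    have hm : ∀ R : Measure 𝒵, Measurable fun ω => ∑' i, scaledTime Q R ω i ^ (-α) := fun R =>
      Measurable.tsum fun i => by fun_prop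
    have := hm P
    exact (measurableSet_le (hm P') (by fun_prop)).compl
  have hBμ : jointLaw Q B ≤ ENNReal.ofReal (2 * δ') :=
    measure_total_ratio_le Q P P' hP hP' hα hε0 hε1 hδ0 hβ hδ1
  have hS1 : ∀ k, Measurable fun ω : (ℕ → ℝ) × (ℕ → 𝒵) =>
      S.indicator (1 : (ℕ → 𝒵) × ℕ → ℝ≥0∞) (ω.2, k) := fun k =>
    (measurable_one.indicator hS).comp (by fun_prop)
  have hsm : Measurable fun ω : (ℕ → ℝ) × (ℕ → 𝒵) =>
      ∑' k, S.indicator 1 (ω.2, k) * indexProb α Q P' ω k :=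
    Measurable.tsum fun k => (hS1 k).mul (measurable_indexProb α Q P' k)
  have hem : Measurable fun ω : (ℕ → ℝ) × (ℕ → 𝒵) =>
      ∑' k, excess c Q P P' (ω.2 k) * indexProb α Q P ω k :=
    Measurable.tsum fun k => ((measurable_excess c Q P P').comp (by fun_prop)).mul
      (measurable_indexProb α Q P k)
  have hpt : ∀ ω : (ℕ → ℝ) × (ℕ → 𝒵), ∑' k, S.indicator 1 (ω.2, k) * indexProb α Q P ω k
      ≤ c ^ α * D * (∑' k, S.indicator 1 (ω.2, k) * indexProb α Q P' ω k)
        + (∑' k, excess c Q P P' (ω.2 k) * indexProb α Q P ω k + B.indicator 1 ω) := by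
    intro ω
    have hind : ∀ k, S.indicator (1 : (ℕ → 𝒵) × ℕ → ℝ≥0∞) (ω.2, k) ≤ 1 := fun k =>
      Set.indicator_le_self' (fun _ _ => zero_le_one) _
    -- Where the totals are not comparable, the index probabilities still sum to at most 1, which
    -- the indicator of `B` pays for.
    by_cases hω : ω ∈ B
    · rw [Set.indicator_of_mem hω]
      refine le_add_left (le_add_left ?_)
      calc _ ≤ ∑' k, indexProb α Q P ω k :=
            ENNReal.tsum_le_tsum fun k => mul_le_of_le_one_left' (hind k)
        _ ≤ 1 := by
            simp only [indexProb, div_eq_mul_inv, ENNReal.tsum_mul_right]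
            exact ENNReal.mul_inv_le_one _
    · rw [Set.indicator_of_notMem hω, add_zero, ← ENNReal.tsum_mul_left, ← ENNReal.tsum_add]
      refine ENNReal.tsum_le_tsum fun k => ?_
      have h := indexProb_le hα.le hα2 hc hcT (d := D)
        (by rw [hD]; simp [Real.exp_pos]) ENNReal.ofReal_ne_top Q P P' (not_not.1 hω) k
      calc S.indicator 1 (ω.2, k) * indexProb α Q P ω k
          ≤ S.indicator 1 (ω.2, k) * (c ^ α * D * indexProb α Q P' ω k
            + excess c Q P P' (ω.2 k) * indexProb α Q P ω k) := by gcongr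
        _ = c ^ α * D * (S.indicator 1 (ω.2, k) * indexProb α Q P' ω k)
            + S.indicator 1 (ω.2, k) * (excess c Q P P' (ω.2 k) * indexProb α Q P ω k) := by ring
        _ ≤ _ := add_le_add_right (mul_le_of_le_one_left' (hind k)) _
  rw [law_apply α Q P hS, law_apply α Q P' hS]
  refine (lintegral_mono hpt).trans ?_
  rw [lintegral_add_left (by fun_prop), lintegral_const_mul _ hsm, lintegral_add_left hem,
    lintegral_indicator_one hBm]
  gcongr
  exact (lintegral_select_le Q P hP (by linarith) (measurable_excess c Q P P')).trans
    (lintegral_excess_le hcT Q P P' hP hP' hDP)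

end PPR

/-! ### The constants of the theorem -/

theorem mainTheorem11 {𝒳 𝒵 : Type*} [MeasurableSpace 𝒵]
    (N : 𝒳 → 𝒳 → Prop) (hN : ∀ x x', N x x' → N x' x)
    (Q : Measure 𝒵) [IsProbabilityMeasure Q]
    (P : 𝒳 → Measure 𝒵) [∀ x, IsProbabilityMeasure (P x)] (hPQ : ∀ x, P x ≪ Q)
    (ε δ : ℝ) (hε : 0 ≤ ε) (hδ : 0 ≤ δ) (hDP : IsDP N ε δ P)
    (α : ℝ) (hα : 1 < α) (ε' δ' : ℝ) (hε'0 : 0 < ε') (hε'1 : ε' ≤ 1)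
    (hδ'0 : 0 < δ') (hδ'1 : δ' ≤ 1 / 3)
    (hαle : α ≤ Real.exp (-4.2) * δ' * ε' ^ 2 / (-Real.log δ') + 1) :
    IsDP N (α * ε + ε') (2 * (δ + δ')) (fun x => PPR.law α Q (P x)) := by
  -- Since 1/3 < 1/e, the logarithm in the hypothesis is at least 1 in absolute value, and nothing
  -- more is needed from it.
  have hlog : 1 ≤ -Real.log δ' := by
    have h1 : δ' ≤ Real.exp (-1) := by
      rw [Real.exp_neg]
      refine hδ'1.trans ?_
      rw [one_div]
      exact inv_anti₀ (Real.exp_pos _) (by linarith [Real.exp_one_lt_d9])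
    have := Real.log_le_log hδ'0 h1
    rw [Real.log_exp] at this
    linarith
  -- The 32 is the constant required by `law_le`, coming from the Chebyshev estimates.
  have hexp : Real.exp (-4.2) ≤ 1 / 32 := by
    have h1 : (32 : ℝ) ≤ Real.exp 4.2 := by
      calc (32 : ℝ) ≤ 2.7 ^ 4 := by norm_num
        _ ≤ Real.exp 1 ^ 4 := by
            gcongr
            linarith [Real.exp_one_gt_d9]
        _ = Real.exp 4 := by rw [← Real.exp_nat_mul]; norm_num
        _ ≤ Real.exp 4.2 := Real.exp_le_exp.2 (by norm_num)
    rw [Real.exp_neg, one_div]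
    exact inv_anti₀ (by norm_num) h1
  have hβ : α - 1 ≤ δ' * ε' ^ 2 / 32 := by
    have hpos : 0 ≤ δ' * ε' ^ 2 := by positivity
    calc α - 1 ≤ Real.exp (-4.2) * δ' * ε' ^ 2 / (-Real.log δ') := by linarith
      _ ≤ Real.exp (-4.2) * δ' * ε' ^ 2 := div_le_self (by positivity) hlog
      _ ≤ δ' * ε' ^ 2 / 32 := by nlinarith
  have hα2 : α ≤ 2 := by
    have : ε' ^ 2 ≤ 1 := pow_le_one₀ hε'0.le hε'1
    nlinarith
  intro x x' hx S hS
  have h := PPR.law_le (hPQ x) (hPQ x') hα hα2 hε'0 hε'1 hδ'0 (by linarith) hβ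
    (by simp [Real.exp_pos]) ENNReal.ofReal_ne_top (hDP x x' hx) hS
  refine h.trans (le_of_eq ?_)
  congr 1
  · rw [ENNReal.ofReal_rpow_of_pos (Real.exp_pos _), ← Real.exp_mul,
      ← ENNReal.ofReal_mul (Real.exp_nonneg _), ← Real.exp_add, mul_comm ε]
  · rw [mul_add, ENNReal.ofReal_add (by positivity) (by positivity),
      ENNReal.ofReal_mul zero_le_two, ENNReal.ofReal_mul zero_le_two, ENNReal.ofReal_ofNat]
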